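/- Let $\mathbf k$ be a field of characteristic zero, let $\Omega$ be a nonempty finite set and let $\mathcal P=\mathcal T(F)/\langle S\rangle$ be a finitely generated binary quadratic nonsymmetric (ns) operad: $\mathcal T(F)$ is the free ns operad on a finite-dimensional space $F$ of binary generators with basis $1,\dots,s$, and $S\subseteq\mathcal T(F)_3$ is a set of relations $$r=\sum_{i,j}\kappa^{1}_{ij}\,(x\,i\,y)\,j\,z+\kappa^{2}_{ij}\,x\,i\,(y\,j\,z).$$ *Matching operad.* For $\omega\in\Omega$ let $F_\omega$ be a copy of $F$ with basis $i_\omega$ ($1\le i\le s$), and for $\mu,\nu\in\Omega$ let $S^{\mu,\nu}$ be the set of all $\sum_{i,j}\kappa^{1}_{ij}(x\,i_\mu\,y)\,j_\nu\,z+\kappa^{2}_{ij}\,x\,i_\mu\,(y\,j_\nu\,z)$ with $r\in S$ as above. Then $$\mathrm{Mat}(\mathcal P)_\Omega:=\mathcal T\Big(\bigoplus_{\omega}F_\omega\Big)\Big/\Big\langle\bigcup_{\omega}S^{\omega,\omega}\cup\bigcup_{\mu\ne\nu}S^{\mu,\nu}\Big\rangle .$$ *Manin products.* Let $\mathcal T(E)/\langle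 R\rangle$ and $\mathcal T(F)/\langle S\rangle$ be two finitely generated binary quadratic ns operads, with chosen bases of $E$ and $F$ and with coefficients $\kappa$ for $r\in R$ and $\kappa'$ for $r'\in S$. The black (square) product is $\mathcal T(E\otimes F)/\langle R\,\blacksquare\, S\rangle$, where $R\,\blacksquare\, S$ consists of the elements, for $r\in R$ and $r'\in S$, $$\sum_{i,j}\sum_{p,q}\kappa^{1}_{ij}\kappa'^{1}_{pq}\,(x\,(i\otimes p)\,y)\,(j\otimes q)\,z-\kappa^{2}_{ij}\kappa'^{2}_{pq}\,x\,(i\otimes p)\,(y\,(j\otimes q)\,z).$$ The white (square) product is $\mathcal T(E\otimes F)/\langle R\,\square\, S\rangle$, where $$R\,\square\, S:=\Phi^{-1}\big(\mathbf kR\otimes\mathcal T(F)_3+\mathcal T(E)_3\otimes\mathbf kS\big)$$ and $\Phi:\mathcal T(E\otimes F)_3\to\mathcal T(E)_3\otimes\mathcal T(F)_3$ is the natural map sending $(x\,(i\otimes p)\,y)\,(j\otimes q)\,z$ to $(x\,i\,y)\,j\,z\otimes(x\,p\,y)\,q\,z$ and $x\,(i\otimes p)\,(y\,(j\otimes q)\,z)$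 to $x\,i\,(y\,j\,z)\otimes x\,p\,(y\,q\,z)$. Let $\mathrm{As}$ be the associative operad, with one binary generator and the relation $(xy)z-x(yz)$. Then there are isomorphisms of ns operads $$\mathrm{Mat}(\mathcal P)_\Omega\;\cong\;\mathrm{Mat}(\mathrm{As})_\Omega\,\blacksquare\,\mathcal P\qquad\text{and}\qquad \mathrm{Mat}(\mathcal P)_\Omega\;\cong\;\mathrm{Mat}(\mathrm{As})_\Omega\,\square\,\mathcal P .$$ -/

import Mathlib

universe u v w

/-! ### Nonsymmetric operads -/

/-- A nonsymmetric operad over `k`: an arity graded vector space with a unit in arity one and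
composition maps `γ(μ; ν₁, …, νₘ)`, linear in `μ` and multilinear in the `νᵢ`, which are associative
and unital. The arity `N` of the result is carried together with a proof of `n₁ + ⋯ + nₘ = N`. -/
structure NSOperad (k : Type u) [Field k] where
  /-- The space of operations of arity `n`. -/
  Op : ℕ → Type v
  [addCommGroup : ∀ n, AddCommGroup (Op n)]
  [module : ∀ n, Module k (Op n)]
  /-- The identity operation. -/
  one : Op 1
  /-- The composition map `γ`. -/
  comp : ∀ {m : ℕ} (n : Fin m → ℕ) (N : ℕ), ∑ i, n i = N →
    (Op m →ₗ[k] MultilinearMap k (fun i => Op (n i)) (Op N))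
  assoc : ∀ {m : ℕ} (n : Fin m → ℕ) (l : ∀ i, Fin (n i) → ℕ) (N : ℕ)
    (h₁ : ∑ i, ∑ j, l i j = N)
    (h₂ : ∑ p : Fin (∑ i, n i), l (finSigmaFinEquiv.symm p).1 (finSigmaFinEquiv.symm p).2 = N)
    (μ : Op m) (ν : ∀ i, Op (n i)) (ω : ∀ i j, Op (l i j)),
    comp (fun i => ∑ j, l i j) N h₁ μ (fun i => comp (l i) (∑ j, l i j) rfl (ν i) (ω i)) =
      comp (fun p => l (finSigmaFinEquiv.symm p).1 (finSigmaFinEquiv.symm p).2) N h₂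
        (comp n (∑ i, n i) rfl μ ν)
        (fun p => ω (finSigmaFinEquiv.symm p).1 (finSigmaFinEquiv.symm p).2)
  one_comp : ∀ {n : ℕ} (h : ∑ _i : Fin 1, n = n) (μ : Op n),
    comp (fun _ : Fin 1 => n) n h one (fun _ => μ) = μ
  comp_one : ∀ {n : ℕ} (h : ∑ _i : Fin n, 1 = n) (μ : Op n),
    comp (fun _ : Fin n => 1) n h μ (fun _ => one) = μ

namespace NSOperad

attribute [instance] NSOperad.addCommGroup NSOperad.module

variable {k : Type u} [Field k]

/-- An isomorphism of nonsymmetric operads: linear isomorphisms in every arity, compatible with the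
units and with the compositions. -/
structure Iso (P : NSOperad.{u, v} k) (Q : NSOperad.{u, w} k) where
  /-- The isomorphism in arity `n`. -/
  equiv : ∀ n, P.Op n ≃ₗ[k] Q.Op n
  map_one : equiv 1 P.one = Q.one
  map_comp : ∀ {m : ℕ} (n : Fin m → ℕ) (N : ℕ) (h : ∑ i, n i = N)
    (μ : P.Op m) (ν : ∀ i, P.Op (n i)),
    equiv N (P.comp n N h μ ν) = Q.comp n N h (equiv m μ) (fun i => equiv (n i) (ν i))

/-- An operadic ideal: an arity graded subspace which contains a composition as soon as it contains
one of the composed operations. -/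
def IsIdeal (P : NSOperad.{u, v} k) (I : ∀ n, Submodule k (P.Op n)) : Prop :=
  ∀ {m : ℕ} (n : Fin m → ℕ) (N : ℕ) (h : ∑ i, n i = N) (μ : P.Op m) (ν : ∀ i, P.Op (n i)),
    (μ ∈ I m ∨ ∃ i, ν i ∈ I (n i)) → P.comp n N h μ ν ∈ I N

/-- The operadic ideal `⟨R⟩` generated by a set `R` of operations of arbitrary arities: the smallest
operadic ideal which contains `R`. -/
def idealSpan (P : NSOperad.{u, v} k) (R : Set (Σ n, P.Op n)) (n : ℕ) : Submodule k (P.Op n) :=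
  sInf {J | ∃ I : ∀ n, Submodule k (P.Op n),
    P.IsIdeal I ∧ (∀ r ∈ R, r.2 ∈ I r.1) ∧ I n = J}

theorem mem_idealSpan {P : NSOperad.{u, v} k} {R : Set (Σ n, P.Op n)} {n : ℕ} {x : P.Op n} :
    x ∈ P.idealSpan R n ↔ ∀ I : ∀ n, Submodule k (P.Op n),
      P.IsIdeal I → (∀ r ∈ R, r.2 ∈ I r.1) → x ∈ I n := by
  simp only [idealSpan, Submodule.mem_sInf, Set.mem_ofPred_eq]
  constructor
  · intro h I hI hR
    exact h _ ⟨I, hI, hR, rfl⟩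
  · rintro h _ ⟨I, hI, hR, rfl⟩
    exact h I hI hR

theorem isIdeal_idealSpan (P : NSOperad.{u, v} k) (R : Set (Σ n, P.Op n)) :
    P.IsIdeal (P.idealSpan R) := by
  intro m n N h μ ν hmem
  rw [mem_idealSpan]
  intro I hI hR
  apply hI
  rcases hmem with hμ | ⟨i, hi⟩
  · exact Or.inl (mem_idealSpan.1 hμ I hI hR)
  · exact Or.inr ⟨i, mem_idealSpan.1 hi I hI hR⟩

theorem IsIdeal.comp_sub_mem {P : NSOperad.{u, v} k} {I : ∀ n, Submodule k (P.Op n)}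
    (hI : P.IsIdeal I) {m : ℕ} (n : Fin m → ℕ) (N : ℕ) (h : ∑ i, n i = N) (μ μ' : P.Op m)
    (ν ν' : ∀ i, P.Op (n i)) (hμ : μ - μ' ∈ I m) (hν : ∀ i, ν i - ν' i ∈ I (n i)) :
    P.comp n N h μ ν - P.comp n N h μ' ν' ∈ I N := by
  classical
  have key : ∀ s : Finset (Fin m),
      P.comp n N h μ' (s.piecewise ν ν') - P.comp n N h μ' ν' ∈ I N := by
    intro s
    induction s using Finset.induction_on with
    | empty => simp
    | insert i s hi ih =>
      rw [Finset.piecewise_insert]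
      have e : P.comp n N h μ' (Function.update (s.piecewise ν ν') i (ν i)) -
          P.comp n N h μ' (s.piecewise ν ν') ∈ I N := by
        have e1 : P.comp n N h μ' (s.piecewise ν ν') =
            P.comp n N h μ' (Function.update (s.piecewise ν ν') i (ν' i)) := by
          congr 1
          rw [eq_comm, Function.update_eq_self_iff]
          simp [hi]
        rw [e1, ← MultilinearMap.map_update_sub]
        exact hI n N h _ _ (Or.inr ⟨i, by simpa using hν i⟩)
      have := (I N).add_mem e ih
      simpa using this
  have h1 : P.comp n N h μ ν - P.comp n N h μ' ν ∈ I N := by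
    have : P.comp n N h μ ν - P.comp n N h μ' ν = P.comp n N h (μ - μ') ν := by simp
    rw [this]
    exact hI n N h _ _ (Or.inl hμ)
  have h2 := key Finset.univ
  rw [Finset.piecewise_univ] at h2
  simpa using (I N).add_mem h1 h2

/-- The composition of the quotient by an operadic ideal, computed on representatives. -/
noncomputable def quotientComp (P : NSOperad.{u, v} k) (I : ∀ n, Submodule k (P.Op n))
    (hI : P.IsIdeal I) {m : ℕ} (n : Fin m → ℕ) (N : ℕ) (h : ∑ i, n i = N) :
    (P.Op m ⧸ I m) →ₗ[k] MultilinearMap k (fun i => P.Op (n i) ⧸ I (n i)) (P.Op N ⧸ I N) :=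
  (I m).liftQ
    { toFun := fun μ =>
        { toFun := fun ν => (I N).mkQ (P.comp n N h μ (fun i => Quotient.out (ν i)))
          map_update_add' := by
            intro _ ν i x y
            rw [← map_add, ← sub_eq_zero, ← map_sub, Submodule.mkQ_apply,
              Submodule.Quotient.mk_eq_zero]
            have e : ∀ z, P.comp n N h μ (fun j => Quotient.out (Function.update ν i z j)) =
                P.comp n N h μ
                  (Function.update (fun j => Quotient.out (ν j)) i (Quotient.out z)) := by
              intro z
              congr 1
              funext j
              by_cases hj : j = i
              · subst hj; simp
              · simp [hj]
            rw [e, e, e, ← MultilinearMap.map_update_add]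
            refine hI.comp_sub_mem n N h _ _ _ _ (by simp) ?_
            intro j
            by_cases hj : j = i
            · subst hj
              rw [Function.update_self, Function.update_self,
                ← Submodule.Quotient.mk_eq_zero, Submodule.Quotient.mk_sub,
                Submodule.Quotient.mk_add]
              have o : ∀ z : P.Op (n j) ⧸ I (n j),
                  Submodule.Quotient.mk (p := I (n j)) (Quotient.out z) = z :=
                fun z => Quotient.out_eq z
              rw [o, o, o, sub_self]
            · simp [hj]
          map_update_smul' := by
            intro _ ν i c x
            rw [← map_smul, ← sub_eq_zero, ← map_sub, Submodule.mkQ_apply,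
              Submodule.Quotient.mk_eq_zero]
            have e : ∀ z, P.comp n N h μ (fun j => Quotient.out (Function.update ν i z j)) =
                P.comp n N h μ
                  (Function.update (fun j => Quotient.out (ν j)) i (Quotient.out z)) := by
              intro z
              congr 1
              funext j
              by_cases hj : j = i
              · subst hj; simp
              · simp [hj]
            rw [e, e, ← MultilinearMap.map_update_smul]
            refine hI.comp_sub_mem n N h _ _ _ _ (by simp) ?_
            intro j
            by_cases hj : j = i
            · subst hj
              rw [Function.update_self, Function.update_self,
                ← Submodule.Quotient.mk_eq_zero, Submodule.Quotient.mk_sub,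
                Submodule.Quotient.mk_smul]
              have o : ∀ z : P.Op (n j) ⧸ I (n j),
                  Submodule.Quotient.mk (p := I (n j)) (Quotient.out z) = z :=
                fun z => Quotient.out_eq z
              rw [o, o, sub_self]
            · simp [hj] }
      map_add' := by
        intro μ μ'
        ext ν
        simp
      map_smul' := by
        intro c μ
        ext ν
        simp }
    (by
      intro μ hμ
      rw [LinearMap.mem_ker]
      ext ν
      change (I N).mkQ _ = 0
      rw [Submodule.mkQ_apply, Submodule.Quotient.mk_eq_zero]
      exact hI n N h _ _ (Or.inl hμ))

/-- The composition of classes is the class of the composition. -/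
theorem quotientComp_mk (P : NSOperad.{u, v} k) (I : ∀ n, Submodule k (P.Op n))
    (hI : P.IsIdeal I) {m : ℕ} (n : Fin m → ℕ) (N : ℕ) (h : ∑ i, n i = N)
    (μ : P.Op m) (ν : ∀ i, P.Op (n i)) :
    P.quotientComp I hI n N h (Submodule.Quotient.mk μ)
      (fun i => Submodule.Quotient.mk (ν i)) = Submodule.Quotient.mk (P.comp n N h μ ν) := by
  change Submodule.Quotient.mk (P.comp n N h μ _) = _
  rw [Submodule.Quotient.eq]
  refine hI.comp_sub_mem n N h _ _ _ _ (by simp) ?_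
  intro i
  rw [← Submodule.Quotient.eq]
  exact Quotient.out_eq _

/-- The quotient of a nonsymmetric operad by an operadic ideal. -/
noncomputable def quotient (P : NSOperad.{u, v} k) (I : ∀ n, Submodule k (P.Op n))
    (hI : P.IsIdeal I) : NSOperad.{u, v} k where
  Op n := P.Op n ⧸ I n
  one := Submodule.Quotient.mk P.one
  comp n N h := P.quotientComp I hI n N h
  assoc := by
    intro m n l N h₁ h₂ μ ν ω
    obtain ⟨μ, rfl⟩ := Submodule.Quotient.mk_surjective _ μ
    choose ν' hν using fun i => Submodule.Quotient.mk_surjective _ (ν i)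
    choose ω' hω using fun i j => Submodule.Quotient.mk_surjective _ (ω i j)
    obtain rfl : (fun i => Submodule.Quotient.mk (ν' i)) = ν := funext hν
    obtain rfl : (fun i j => Submodule.Quotient.mk (ω' i j)) = ω :=
      funext fun i => funext fun j => hω i j
    simp only [quotientComp_mk]
    rw [P.assoc n l N h₁ h₂]
  one_comp := by
    intro n h μ
    obtain ⟨μ, rfl⟩ := Submodule.Quotient.mk_surjective _ μ
    rw [quotientComp_mk, P.one_comp]
  comp_one := by
    intro n h μ
    obtain ⟨μ, rfl⟩ := Submodule.Quotient.mk_surjective _ μ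
    rw [quotientComp_mk, P.comp_one]

end NSOperad

/-! ### The free nonsymmetric operad on binary generators -/

namespace BinaryTree

variable {X : Type v}

/-- `t.graft f` is obtained from `t` by grafting the root of `f j` to the `j`-th leaf of `t`; the
leaves are numbered `0, 1, 2, …` from left to right. -/
def graft : BinaryTree X → (ℕ → BinaryTree X) → BinaryTree X
  | nil, f => f 0
  | node x l r, f => node x (graft l f) (graft r (fun j => f (l.numLeaves + j)))

theorem numLeaves_graft (t : BinaryTree X) (f : ℕ → BinaryTree X) :
    (t.graft f).numLeaves = ∑ j ∈ Finset.range t.numLeaves, (f j).numLeaves := by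
  induction t generalizing f with
  | nil => simp [graft]
  | node x l r hl hr => simp [graft, hl, hr, Finset.sum_range_add]

theorem graft_congr (t : BinaryTree X) {f g : ℕ → BinaryTree X}
    (h : ∀ j < t.numLeaves, f j = g j) : t.graft f = t.graft g := by
  induction t generalizing f g with
  | nil => exact h 0 (by simp)
  | node x l r hl hr =>
    simp only [graft]
    rw [hl fun j hj => h j (by simp; omega), hr fun j hj => h _ (by simp; omega)]

theorem graft_nil (t : BinaryTree X) : t.graft (fun _ => nil) = t := by
  induction t with
  | nil => rfl
  | node x l r hl hr => simp [graft, hl, hr]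

theorem graft_graft (t : BinaryTree X) (f g : ℕ → BinaryTree X) :
    (t.graft f).graft g = t.graft (fun j => (f j).graft
      (fun p => g (∑ a ∈ Finset.range j, (f a).numLeaves + p))) := by
  induction t generalizing f g with
  | nil => simp [graft]
  | node x l r hl hr =>
    simp only [graft, hl, hr, numLeaves_graft, Finset.sum_range_add, add_assoc]

end BinaryTree

/-- Planar rooted trees with `n` leaves whose internal vertices are binary and decorated by elements
of `X`. The tree with a single leaf and no internal vertex is `BinaryTree.nil`. -/
abbrev PlanarTree (X : Type v) (n : ℕ) : Type v := {t : BinaryTree X // t.numLeaves = n}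

namespace PlanarTree

variable {X : Type v}

/-- The tree `t(t₁, …, tₘ)`: the root of `tᵢ` is grafted to the `i`-th leaf of `t`. -/
def graft {m : ℕ} {n : Fin m → ℕ} {N : ℕ} (h : ∑ i, n i = N) (t : PlanarTree X m)
    (s : ∀ i, PlanarTree X (n i)) : PlanarTree X N :=
  ⟨t.1.graft (fun j => if hj : j < m then (s ⟨j, hj⟩).1 else BinaryTree.nil), by
    rw [BinaryTree.numLeaves_graft, t.2, Finset.sum_range, ← h]
    refine Finset.sum_congr rfl fun i _ => ?_
    simpa using (s i).2⟩

theorem graft_assoc {m : ℕ} (n : Fin m → ℕ) (l : ∀ i, Fin (n i) → ℕ) (N : ℕ)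
    (h₁ : ∑ i, ∑ j, l i j = N)
    (h₂ : ∑ p : Fin (∑ i, n i), l (finSigmaFinEquiv.symm p).1 (finSigmaFinEquiv.symm p).2 = N)
    (t : PlanarTree X m) (s : ∀ i, PlanarTree X (n i)) (r : ∀ i j, PlanarTree X (l i j)) :
    graft h₁ t (fun i => graft rfl (s i) (r i)) =
      graft h₂ (graft rfl t s)
        (fun p => r (finSigmaFinEquiv.symm p).1 (finSigmaFinEquiv.symm p).2) := by
  apply Subtype.ext
  simp only [graft]
  rw [BinaryTree.graft_graft]
  apply BinaryTree.graft_congr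
  intro i hi
  rw [t.2] at hi
  simp only [hi, dif_pos]
  apply BinaryTree.graft_congr
  intro j hj
  rw [(s ⟨i, hi⟩).2] at hj
  have e : ∑ a ∈ Finset.range i,
      (if ha : a < m then (s ⟨a, ha⟩).1 else BinaryTree.nil).numLeaves + j =
      (finSigmaFinEquiv (⟨⟨i, hi⟩, ⟨j, hj⟩⟩ : (i : Fin m) × Fin (n i)) : ℕ) := by
    rw [finSigmaFinEquiv_apply, Finset.sum_range]
    congr 1
    refine Finset.sum_congr rfl fun a _ => ?_
    have ha : (a : ℕ) < m := a.2.trans hi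
    rw [dif_pos ha]
    exact (s ⟨a, ha⟩).2
  rw [e, dif_pos hj, dif_pos (Fin.is_lt _), Fin.eta, Equiv.symm_apply_apply]

/-- The tree `(x i y) j z`: the root is decorated by `j` and its left input is the vertex `i`. -/
def left (i j : X) : PlanarTree X 3 :=
  ⟨.node j (.node i .nil .nil) .nil, rfl⟩

/-- The tree `x i (y j z)`: the root is decorated by `i` and its right input is the vertex `j`. -/
def right (i j : X) : PlanarTree X 3 :=
  ⟨.node i .nil (.node j .nil .nil), rfl⟩

/-- Change of decorations. -/
def map {Y : Type w} (f : X → Y) {n : ℕ} (t : PlanarTree X n) : PlanarTree Y n :=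
  ⟨t.1.map f, by
    obtain ⟨t, rfl⟩ := t
    induction t with
    | nil => rfl
    | node x l r hl hr => simpa [BinaryTree.map] using congrArg₂ (· + ·) hl hr⟩

end PlanarTree

section MultiExtend

variable (k : Type u) [Field k] {m : ℕ} {κ : Fin m → Type v} {B : Type w}

open Classical in
/-- The multilinear extension of a map `φ` defined on families of basis elements. -/
noncomputable def multiExtend (φ : (∀ i, κ i) → B) :
    MultilinearMap k (fun i => κ i →₀ k) (B →₀ k) :=
  (MultilinearMap.fromDFinsuppEquiv κ k (M := fun _ _ => k)
    (fun p => MultilinearMap.mkPiRing k (Fin m) (Finsupp.single (φ p) (1 : k)))).compLinearMap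
    (fun i => (finsuppLequivDFinsupp (ι := κ i) (M := k) k).toLinearMap)

theorem multiExtend_single (φ : (∀ i, κ i) → B) (p : ∀ i, κ i) :
    multiExtend k φ (fun i => Finsupp.single (p i) 1) = Finsupp.single (φ p) 1 := by
  classical
  simp [multiExtend, finsuppLequivDFinsupp, Finsupp.toDFinsupp_single]

/-- Evaluation of multilinear maps at a fixed family of arguments. -/
def multiEval {ι : Type*} {M : ι → Type*} {N : Type*} [∀ i, AddCommGroup (M i)]
    [∀ i, Module k (M i)] [AddCommGroup N] [Module k N] (x : ∀ i, M i) :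
    MultilinearMap k M N →ₗ[k] N where
  toFun f := f x
  map_add' _ _ := rfl
  map_smul' _ _ := rfl

theorem multi_ext {N : Type*} [AddCommGroup N] [Module k N] {ι : Type*} [Finite ι]
    {κ : ι → Type*} {f g : MultilinearMap k (fun i => κ i →₀ k) N}
    (h : ∀ p : ∀ i, κ i, f (fun i => Finsupp.single (p i) 1) =
      g (fun i => Finsupp.single (p i) 1)) : f = g :=
  Module.Basis.ext_multilinear (fun _ => Finsupp.basisSingleOne) (by simpa using h)

end MultiExtend

namespace NSOperad

variable (k : Type u) [Field k] (X : Type v)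

/-- The composition of the free operad: the grafting of trees, extended linearly in every argument.
-/
noncomputable def freeComp {m : ℕ} (n : Fin m → ℕ) (N : ℕ) (h : ∑ i, n i = N) :
    (PlanarTree X m →₀ k) →ₗ[k]
      MultilinearMap k (fun i => PlanarTree X (n i) →₀ k) (PlanarTree X N →₀ k) :=
  Finsupp.linearCombination k (fun t => multiExtend k (fun s => PlanarTree.graft h t s))

theorem freeComp_single {m : ℕ} (n : Fin m → ℕ) (N : ℕ) (h : ∑ i, n i = N)
    (t : PlanarTree X m) (s : ∀ i, PlanarTree X (n i)) :
    freeComp k X n N h (Finsupp.single t 1) (fun i => Finsupp.single (s i) 1) =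
      Finsupp.single (PlanarTree.graft h t s) 1 := by
  simp [freeComp, multiExtend_single]

/-- The free nonsymmetric operad `𝒯(E)` on the arity graded vector space `E` which is concentrated in
arity two and has the basis `X` there. Its operations of arity `n` are the linear combinations of
planar trees with `n` leaves whose internal vertices are binary and decorated by `X`. -/
noncomputable def free : NSOperad.{u, max u v} k where
  Op n := PlanarTree X n →₀ k
  one := Finsupp.single ⟨.nil, rfl⟩ 1
  comp n N h := freeComp k X n N h
  assoc := by
    intro m n l N h₁ h₂ μ ν ω
    induction μ using Finsupp.induction_linear with
    | zero => simp
    | add a b ha hb => simp only [map_add, add_apply, ha, hb]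
    | single t c =>
      rw [← mul_one c, ← smul_eq_mul, ← Finsupp.smul_single]
      simp only [map_smul, smul_apply]
      congr 1
      have h3 : ∀ s : ∀ i, PlanarTree X (n i),
          (freeComp k X (fun i => ∑ j, l i j) N h₁ (Finsupp.single t 1)).compMultilinearMap
            (fun i => freeComp k X (l i) (∑ j, l i j) rfl (Finsupp.single (s i) 1)) =
          (MultilinearMap.domDomCongrLinearEquiv' k k
            (fun p : (i : Fin m) × Fin (n i) => PlanarTree X (l p.1 p.2) →₀ k)
            (PlanarTree X N →₀ k) finSigmaFinEquiv).symm
          (freeComp k X (fun p => l (finSigmaFinEquiv.symm p).1 (finSigmaFinEquiv.symm p).2) N h₂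
            (freeComp k X n (∑ i, n i) rfl (Finsupp.single t 1)
              (fun i => Finsupp.single (s i) 1))) := by
        intro s
        apply multi_ext
        intro p
        simp only [MultilinearMap.compMultilinearMap_apply,
          MultilinearMap.domDomCongrLinearEquiv'_symm_apply, MultilinearMap.coe_mk,
          Function.comp_apply]
        have e1 : ∀ i, freeComp k X (l i) (∑ j, l i j) rfl (Finsupp.single (s i) 1)
            (fun j => Finsupp.single (p ⟨i, j⟩) (1 : k)) =
            Finsupp.single (PlanarTree.graft rfl (s i) (fun j => p ⟨i, j⟩)) 1 := fun i =>
          freeComp_single k X (l i) _ rfl (s i) (fun j => p ⟨i, j⟩)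
        refine (congrArg _ (funext e1)).trans ?_
        rw [freeComp_single, freeComp_single,
          PlanarTree.graft_assoc n l N h₁ h₂ t s (fun i j => p ⟨i, j⟩)]
        exact (freeComp_single k X _ N h₂ _ (fun q => p (finSigmaFinEquiv.symm q))).symm
      have h4 : (freeComp k X (fun i => ∑ j, l i j) N h₁ (Finsupp.single t 1)).compLinearMap
            (fun i => (multiEval k (ω i)).comp (freeComp k X (l i) (∑ j, l i j) rfl)) =
          ((multiEval k (fun p => ω (finSigmaFinEquiv.symm p).1 (finSigmaFinEquiv.symm p).2)).comp
            (freeComp k X (fun p => l (finSigmaFinEquiv.symm p).1 (finSigmaFinEquiv.symm p).2)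
              N h₂)).compMultilinearMap
            (freeComp k X n (∑ i, n i) rfl (Finsupp.single t 1)) := by
        apply multi_ext
        intro s
        exact congrArg (fun f => f (fun q => ω q.1 q.2)) (h3 s)
      exact congrArg (fun f => f ν) h4
  one_comp := by
    intro n h μ
    have key : freeComp k X (fun _ : Fin 1 => n) n h (Finsupp.single ⟨.nil, rfl⟩ 1) =
        MultilinearMap.ofSubsingleton k (PlanarTree X n →₀ k) (PlanarTree X n →₀ k) (0 : Fin 1)
          LinearMap.id := by
      apply multi_ext
      intro p
      rw [freeComp_single]
      rfl
    rw [key]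
    rfl
  comp_one := by
    intro n h μ
    induction μ using Finsupp.induction_linear with
    | zero => simp
    | add a b ha hb => simp only [map_add, add_apply, ha, hb]
    | single t c =>
      rw [← mul_one c, ← smul_eq_mul, ← Finsupp.smul_single]
      simp only [map_smul, smul_apply]
      rw [freeComp_single]
      congr 2
      apply Subtype.ext
      simp [PlanarTree.graft, BinaryTree.graft_nil]

end NSOperad

/-! ### Binary quadratic operads, the matching operad and the Manin products -/

/-- A presentation of a finitely generated binary quadratic nonsymmetric operad: a finite basis `Gen`
of the space `E` of binary generators, and a set `Rel` of relations in the space of elements of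
weight two of `𝒯(E)`. As all vertices are binary, the trees with two vertices are exactly the trees
with three leaves, so that this space is `𝒯(E)₃`, with the basis of all trees `PlanarTree.left i j`
and `PlanarTree.right i j` for `i j : Gen`. -/
structure BinaryQuadraticData (k : Type u) [Field k] where
  /-- The basis of the space of binary generators. -/
  Gen : Type v
  [fintype : Fintype Gen]
  /-- The relations. -/
  Rel : Set (PlanarTree Gen 3 →₀ k)

namespace BinaryQuadraticData

attribute [instance] BinaryQuadraticData.fintype

variable {k : Type u} [Field k]

/-- The operad `𝒯(E)/⟨R⟩`. -/
noncomputable def operad (P : BinaryQuadraticData.{u, v} k) : NSOperad.{u, max u v} k :=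
  (NSOperad.free k P.Gen).quotient
    ((NSOperad.free k P.Gen).idealSpan {r | ∃ x ∈ P.Rel, r = ⟨3, x⟩})
    (NSOperad.isIdeal_idealSpan _ _)

/-- The associative operad: one binary generator, with the relation `(x y) z - x (y z)`. -/
noncomputable def associative (k : Type u) [Field k] : BinaryQuadraticData.{u, 0} k where
  Gen := Unit
  Rel := {Finsupp.single (PlanarTree.left () ()) 1 - Finsupp.single (PlanarTree.right () ()) 1}

/-- The copy of the element `r` of `𝒯(E)₃` on the generators with index `ω`. -/
noncomputable def copyRel {X : Type v} {Ω : Type w} (r : PlanarTree X 3 →₀ k) (ω : Ω) :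
    PlanarTree (Ω × X) 3 →₀ k :=
  Finsupp.mapDomain (PlanarTree.map (fun i => (ω, i))) r

/-- For `r = ∑ κ¹ᵢⱼ (x i y) j z + κ²ᵢⱼ x i (y j z)`, the element
`∑ κ¹ᵢⱼ (x i_μ y) j_ν z + κ²ᵢⱼ x i_μ (y j_ν z)`. -/
noncomputable def mixedRel {X : Type v} [Fintype X] {Ω : Type w} (r : PlanarTree X 3 →₀ k)
    (μ ν : Ω) : PlanarTree (Ω × X) 3 →₀ k :=
  ∑ i, ∑ j, (Finsupp.single (PlanarTree.left (μ, i) (ν, j)) (r (PlanarTree.left i j)) +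
    Finsupp.single (PlanarTree.right (μ, i) (ν, j)) (r (PlanarTree.right i j)))

/-- The matching operad of `P` with parameter set `Ω`: the generators are copies `i_ω = (ω, i)` of
the generators of `P`, one for each `ω`; the relations are the copies of those of `P` for each `ω`,
and the mixed ones for all `μ ≠ ν`. -/
noncomputable def matching (P : BinaryQuadraticData.{u, v} k) (Ω : Type w) [Fintype Ω] :
    BinaryQuadraticData.{u, max v w} k where
  Gen := Ω × P.Gen
  Rel := {x | ∃ ω : Ω, ∃ r ∈ P.Rel, x = copyRel r ω} ∪
    {x | ∃ μ ν : Ω, μ ≠ ν ∧ ∃ r ∈ P.Rel, x = mixedRel r μ ν}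

/-- The relation `r ■ s` on the generators `i ⊗ k = (i, k)`: the coefficients of `r` and `s` are
multiplied, with a minus sign for the trees `PlanarTree.right`. -/
noncomputable def blackRel {X : Type v} {Y : Type w} [Fintype X] [Fintype Y]
    (r : PlanarTree X 3 →₀ k) (s : PlanarTree Y 3 →₀ k) : PlanarTree (X × Y) 3 →₀ k :=
  ∑ i, ∑ j, ∑ a, ∑ b,
    (Finsupp.single (PlanarTree.left (i, a) (j, b))
        (r (PlanarTree.left i j) * s (PlanarTree.left a b)) -
      Finsupp.single (PlanarTree.right (i, a) (j, b))
        (r (PlanarTree.right i j) * s (PlanarTree.right a b)))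

/-- The Manin black (square) product `𝒯(E ⊗ F)/⟨R ■ S⟩`. -/
noncomputable def black (P : BinaryQuadraticData.{u, v} k) (Q : BinaryQuadraticData.{u, w} k) :
    BinaryQuadraticData.{u, max v w} k where
  Gen := P.Gen × Q.Gen
  Rel := {x | ∃ r ∈ P.Rel, ∃ s ∈ Q.Rel, x = blackRel r s}

open scoped TensorProduct in
/-- The natural map `Φ : 𝒯(E ⊗ F)₃ → 𝒯(E)₃ ⊗ 𝒯(F)₃`, which sends a tree decorated by the `iᵥ ⊗ kᵥ`
to the tensor product of the same trees decorated by the `iᵥ` and by the `kᵥ`. -/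
noncomputable def splitDecorations (k : Type u) [Field k] (X : Type v) (Y : Type w) :
    (PlanarTree (X × Y) 3 →₀ k) →ₗ[k] (PlanarTree X 3 →₀ k) ⊗[k] (PlanarTree Y 3 →₀ k) :=
  Finsupp.linearCombination k (fun t =>
    Finsupp.single (t.map Prod.fst) (1 : k) ⊗ₜ[k] Finsupp.single (t.map Prod.snd) (1 : k))

/-- The Manin white (square) product `𝒯(E ⊗ F)/⟨Φ⁻¹(R ⊗ 𝒯(F)₃ + 𝒯(E)₃ ⊗ S)⟩`. -/
noncomputable def white (P : BinaryQuadraticData.{u, v} k) (Q : BinaryQuadraticData.{u, w} k) :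
    BinaryQuadraticData.{u, max v w} k where
  Gen := P.Gen × Q.Gen
  Rel := {x | splitDecorations k P.Gen Q.Gen x ∈
    LinearMap.range (LinearMap.rTensor (PlanarTree Q.Gen 3 →₀ k)
        (Submodule.span k P.Rel).subtype) ⊔
      LinearMap.range (LinearMap.lTensor (PlanarTree P.Gen 3 →₀ k)
        (Submodule.span k Q.Rel).subtype)}

end BinaryQuadraticData

/-! The generators `(ω, i)` of `Mat(P)` and `((ω, ()), i)` of either product differ only by a unit
factor. By `nonempty_iso_of_equiv` it therefore suffices that this relabelling identifies the spans
of the two sets of relations; the ideals, and hence the quotients, then correspond.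

The relations of `Mat(P)` are uniform: the copy of `r` at `ω` is the mixed relation with `μ = ν =
ω`, so they are exactly the `mixedRel r μ ν` for arbitrary `μ` and `ν`. For the associative operad
they are the differences `assocRel k μ ν`, with coefficient `1` on the left tree and `-1` on the
right tree.

Black product: this `-1` cancels the minus sign in the definition of the product, so the product of
`assocRel k μ ν` and `r` is `mixedRel r μ ν` up to relabelling (`blackRel_assocRel`). The two sets
of relations correspond element by element.

White product: modulo the associative relations the left and right trees labelled `μ, ν` agree.
Hence `Φ` sends `mixedRel r μ ν` to `left(μ, ν) ⊗ r` up to a tensor whose first factor is a multiple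
of `assocRel k μ ν` (`splitDecorations_mixedRel`), and it is a relation of the white product.
Conversely, the form `assocCoeff k μ ν` kills all associative relations. Contracting `Φ x` with it
takes a white relation `x` into the span of the relations of `P` (`assocContract_mem`), and `x` is
recovered by summing the mixed relations of these contractions over `μ` and `ν`
(`sum_mixedRel_assocContract`). -/

namespace BinaryTree

/-! ### Relabelling trees, and the two shapes of trees with three leaves. -/

variable {X : Type v} {Y : Type w}

theorem numLeaves_map (f : X → Y) (t : BinaryTree X) : (t.map f).numLeaves = t.numLeaves := by
  induction t with
  | nil => rfl
  | node x l r hl hr => simpa [BinaryTree.map] using congrArg₂ (· + ·) hl hr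

theorem map_graft (f : X → Y) (t : BinaryTree X) (g : ℕ → BinaryTree X) :
    (t.graft g).map f = (t.map f).graft (fun j => (g j).map f) := by
  induction t generalizing g with
  | nil => rfl
  | node x l r hl hr => simp [graft, BinaryTree.map, hl, hr, numLeaves_map]

theorem map_map_of_leftInverse {f : X → Y} {g : Y → X} (h : Function.LeftInverse g f)
    (t : BinaryTree X) : (t.map f).map g = t := by
  induction t with
  | nil => rfl
  | node x l r hl hr => simp [BinaryTree.map, hl, hr, h x]

end BinaryTree

namespace PlanarTree

variable {X : Type v} {Y : Type w}

theorem map_graft (f : X → Y) {m : ℕ} {n : Fin m → ℕ} {N : ℕ} (h : ∑ i, n i = N)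
    (t : PlanarTree X m) (s : ∀ i, PlanarTree X (n i)) :
    (graft h t s).map f = graft h (t.map f) (fun i => (s i).map f) := by
  apply Subtype.ext
  simp only [graft, map, BinaryTree.map_graft]
  congr 1
  funext j
  split_ifs <;> rfl

/-- Relabelling the decorations along a bijection. -/
def mapEquiv (e : X ≃ Y) (n : ℕ) : PlanarTree X n ≃ PlanarTree Y n where
  toFun := map e
  invFun := map e.symm
  left_inv t := Subtype.ext (BinaryTree.map_map_of_leftInverse e.left_inv t.1)
  right_inv t := Subtype.ext (BinaryTree.map_map_of_leftInverse e.right_inv t.1)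

@[simp]
theorem mapEquiv_apply (e : X ≃ Y) {n : ℕ} (t : PlanarTree X n) : mapEquiv e n t = t.map e := rfl

@[simp]
theorem map_left (f : X → Y) (i j : X) : (left i j).map f = left (f i) (f j) := rfl

@[simp]
theorem map_right (f : X → Y) (i j : X) : (right i j).map f = right (f i) (f j) := rfl

/-- Every tree has at least one leaf, so the two subtrees at the root split the three leaves as `1 +
2` or `2 + 1`; trees with one or two leaves have only one shape. -/
theorem eq_left_or_right (t : PlanarTree X 3) :
    (∃ i j, t = left i j) ∨ ∃ i j, t = right i j := by
  have eq_nil : ∀ t : BinaryTree X, t.numLeaves = 1 → t = .nil := by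
    rintro (_ | ⟨x, l, r⟩) h
    · rfl
    · have := l.numLeaves_pos
      have := r.numLeaves_pos
      simp only [BinaryTree.numLeaves] at h
      omega
  have eq_node : ∀ t : BinaryTree X, t.numLeaves = 2 → ∃ x, t = .node x .nil .nil := by
    rintro (_ | ⟨x, l, r⟩) h
    · simp at h
    · have := l.numLeaves_pos
      have := r.numLeaves_pos
      simp only [BinaryTree.numLeaves] at h
      exact ⟨x, by rw [eq_nil l (by omega), eq_nil r (by omega)]⟩
  obtain ⟨_ | ⟨x, l, r⟩, h⟩ := t
  · simp at h
  · have := l.numLeaves_pos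
    have := r.numLeaves_pos
    have h' : l.numLeaves + r.numLeaves = 3 := h
    rcases (by omega : l.numLeaves = 1 ∧ r.numLeaves = 2 ∨ l.numLeaves = 2 ∧ r.numLeaves = 1) with
      ⟨h₁, h₂⟩ | ⟨h₁, h₂⟩
    · obtain ⟨y, rfl⟩ := eq_node r h₂
      obtain rfl := eq_nil l h₁
      exact Or.inr ⟨x, y, rfl⟩
    · obtain ⟨y, rfl⟩ := eq_node l h₁
      obtain rfl := eq_nil r h₂
      exact Or.inl ⟨y, x, rfl⟩

@[simp]
theorem left_inj {i j i' j' : X} : left i j = left i' j' ↔ i = i' ∧ j = j' := by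
  simp [left, Subtype.ext_iff, and_comm]

@[simp]
theorem right_inj {i j i' j' : X} : right i j = right i' j' ↔ i = i' ∧ j = j' := by
  simp [right, Subtype.ext_iff]

@[simp]
theorem left_ne_right (i j i' j' : X) : left i j ≠ right i' j' := by
  simp [left, right, Subtype.ext_iff]

@[simp]
theorem right_ne_left (i j i' j' : X) : right i j ≠ left i' j' := (left_ne_right _ _ _ _).symm

/-- Linear maps out of the space of trees with three leaves are determined by their values on the
trees `left i j` and `right i j`. -/
theorem linearMap_ext {k : Type u} [Field k] {M : Type*} [AddCommMonoid M] [Module k M]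
    {f g : (PlanarTree X 3 →₀ k) →ₗ[k] M}
    (hl : ∀ i j, f (Finsupp.single (left i j) 1) = g (Finsupp.single (left i j) 1))
    (hr : ∀ i j, f (Finsupp.single (right i j) 1) = g (Finsupp.single (right i j) 1)) :
    f = g := by
  refine Finsupp.lhom_ext' fun t => LinearMap.ext_ring ?_
  rcases eq_left_or_right t with ⟨i, j, rfl⟩ | ⟨i, j, rfl⟩
  · exact hl i j
  · exact hr i j

end PlanarTree

/-! ### Isomorphisms of operads, generated ideals and quotients. -/

namespace NSOperad

variable {k : Type u} [Field k]

namespace Iso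

/-- The inverse isomorphism. -/
def symm {P : NSOperad.{u, v} k} {Q : NSOperad.{u, w} k} (φ : Iso P Q) : Iso Q P where
  equiv n := (φ.equiv n).symm
  map_one := by rw [LinearEquiv.symm_apply_eq, φ.map_one]
  map_comp n N h μ ν := by
    rw [LinearEquiv.symm_apply_eq, φ.map_comp]
    simp

/-- Since `φ` respects compositions, the preimage of an ideal is an ideal. Here it contains `R`, so
minimality of the generated ideal applies. Used for `φ` and for its inverse, this identifies two
generated ideals. -/
theorem apply_mem_idealSpan {P : NSOperad.{u, v} k} {Q : NSOperad.{u, w} k} (φ : Iso P Q)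
    {R : Set (Σ n, P.Op n)} {S : Set (Σ n, Q.Op n)}
    (h : ∀ r ∈ R, φ.equiv r.1 r.2 ∈ Q.idealSpan S r.1) {n : ℕ} {x : P.Op n}
    (hx : x ∈ P.idealSpan R n) : φ.equiv n x ∈ Q.idealSpan S n := by
  refine mem_idealSpan.1 hx (fun n => (Q.idealSpan S n).comap (φ.equiv n).toLinearMap) ?_ h
  intro m n N hN μ ν hmem
  simp only [Submodule.mem_comap, LinearEquiv.coe_coe, φ.map_comp] at hmem ⊢
  exact Q.isIdeal_idealSpan S n N hN _ _ hmem

/-- An isomorphism which identifies two ideals induces an isomorphism of the quotients. -/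
noncomputable def quotient {P : NSOperad.{u, v} k} {Q : NSOperad.{u, w} k} (φ : Iso P Q)
    {I : ∀ n, Submodule k (P.Op n)} {J : ∀ n, Submodule k (Q.Op n)} (hI : P.IsIdeal I)
    (hJ : Q.IsIdeal J) (h : ∀ n, (I n).map (φ.equiv n).toLinearMap = J n) :
    Iso (P.quotient I hI) (Q.quotient J hJ) where
  equiv n := Submodule.Quotient.equiv (I n) (J n) (φ.equiv n) (h n)
  map_one := congrArg (Submodule.Quotient.mk (p := J 1)) φ.map_one
  map_comp {m} n N hN μ ν := by
    obtain ⟨μ, rfl⟩ := Submodule.Quotient.mk_surjective _ μ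
    choose ν' hν using fun i => Submodule.Quotient.mk_surjective _ (ν i)
    obtain rfl : (fun i => Submodule.Quotient.mk (ν' i)) = ν := funext hν
    refine (congrArg (Submodule.Quotient.equiv (I N) (J N) (φ.equiv N) (h N))
      (P.quotientComp_mk I hI n N hN μ ν')).trans ?_
    refine Eq.trans ?_ (Q.quotientComp_mk J hJ n N hN (φ.equiv m μ)
      (fun i => φ.equiv (n i) (ν' i))).symm
    exact congrArg (Submodule.Quotient.mk (p := J N)) (φ.map_comp n N hN μ ν')

end Iso

theorem subset_idealSpan {P : NSOperad.{u, v} k} {R : Set (Σ n, P.Op n)} {r : Σ n, P.Op n}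
    (hr : r ∈ R) : r.2 ∈ P.idealSpan R r.1 :=
  mem_idealSpan.2 fun _ _ h => h r hr

/-- Relabelling the generators of a free operad along a bijection. -/
noncomputable def freeIso (k : Type u) [Field k] {X : Type v} {Y : Type w} (e : X ≃ Y) :
    Iso (free k X) (free k Y) where
  equiv n := Finsupp.domLCongr (PlanarTree.mapEquiv e n)
  map_one := Finsupp.domLCongr_single _ _ _
  map_comp {m} n N h μ ν := by
    change Finsupp.domLCongr (PlanarTree.mapEquiv e N) (freeComp k X n N h μ ν) =
      freeComp k Y n N h (Finsupp.domLCongr (PlanarTree.mapEquiv e m) μ)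
        (fun i => Finsupp.domLCongr (PlanarTree.mapEquiv e (n i)) (ν i))
    induction μ using Finsupp.induction_linear with
    | zero =>
      simp only [map_zero]
      exact map_zero (Finsupp.domLCongr (R := k) (M := k) (PlanarTree.mapEquiv e N))
    | add a b ha hb =>
      simp only [map_add, add_apply, ← ha, ← hb]
      exact map_add (Finsupp.domLCongr (R := k) (M := k) (PlanarTree.mapEquiv e N)) _ _
    | single t c =>
      -- Scaling out the coefficient leaves a basis tree as the outer operation.
      rw [← mul_one c, ← smul_eq_mul, ← Finsupp.smul_single]
      simp only [map_smul, smul_apply]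
      refine ((Finsupp.domLCongr (R := k) (M := k) (PlanarTree.mapEquiv e N)).map_smul c _).trans ?_
      congr 1
      -- With the outer tree fixed, both sides are multilinear in the inner operations. It is enough
      -- to compare them on families of trees, where relabelling commutes with grafting.
      have key : LinearMap.compMultilinearMap
            (Finsupp.domLCongr (R := k) (M := k) (PlanarTree.mapEquiv e N)).toLinearMap
            (freeComp k X n N h (Finsupp.single t 1)) =
          (freeComp k Y n N h (Finsupp.domLCongr (R := k) (M := k)
            (PlanarTree.mapEquiv e m) (Finsupp.single t 1))).compLinearMap
            (fun i => (Finsupp.domLCongr (R := k) (M := k)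
              (PlanarTree.mapEquiv e (n i))).toLinearMap) := by
        apply multi_ext
        intro p
        simp only [LinearMap.compMultilinearMap_apply, MultilinearMap.compLinearMap_apply,
          LinearEquiv.coe_coe, Finsupp.domLCongr_single, freeComp_single]
        rw [PlanarTree.mapEquiv_apply, PlanarTree.map_graft]
        rfl
      exact congrArg (fun f => f ν) key

theorem freeIso_equiv_apply {X : Type v} {Y : Type w} (e : X ≃ Y) {n : ℕ}
    (x : PlanarTree X n →₀ k) :
    (freeIso k e).equiv n x = Finsupp.mapDomain (PlanarTree.map e) x :=
  Finsupp.equivMapDomain_eq_mapDomain _ _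

theorem freeIso_symm_equiv_apply {X : Type v} {Y : Type w} (e : X ≃ Y) {n : ℕ}
    (y : PlanarTree Y n →₀ k) :
    (freeIso k e).symm.equiv n y = Finsupp.mapDomain (PlanarTree.map e.symm) y :=
  Finsupp.equivMapDomain_eq_mapDomain (PlanarTree.mapEquiv e n).symm y

end NSOperad

/-! ### Comparing quadratic presentations. -/

namespace BinaryQuadraticData

variable {k : Type u} [Field k]

/-- This is why only spans of relations need to be compared, which matters for the white product,
whose relations form a whole subspace. -/
theorem span_le_idealSpan {X : Type v} (R : Set (PlanarTree X 3 →₀ k)) :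
    Submodule.span k R ≤ (NSOperad.free k X).idealSpan {r | ∃ x ∈ R, r = ⟨3, x⟩} 3 :=
  Submodule.span_le.2 fun x hx =>
    NSOperad.subset_idealSpan (P := NSOperad.free k X) (r := ⟨3, x⟩) ⟨x, hx, rfl⟩

/-- A relabelling of the generators which identifies the spans of the relations induces an
isomorphism of the presented operads. -/
theorem nonempty_iso_of_equiv (P : BinaryQuadraticData.{u, v} k)
    (Q : BinaryQuadraticData.{u, w} k) (e : P.Gen ≃ Q.Gen)
    (h₁ : ∀ r ∈ P.Rel, Finsupp.mapDomain (PlanarTree.map e) r ∈ Submodule.span k Q.Rel)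
    (h₂ : ∀ s ∈ Q.Rel, Finsupp.mapDomain (PlanarTree.map e.symm) s ∈ Submodule.span k P.Rel) :
    Nonempty (NSOperad.Iso P.operad Q.operad) := by
  refine ⟨(NSOperad.freeIso k e).quotient
    (NSOperad.isIdeal_idealSpan _ _) (NSOperad.isIdeal_idealSpan _ _) fun n => le_antisymm ?_ ?_⟩
  · rintro _ ⟨x, hx, rfl⟩
    refine (NSOperad.freeIso k e).apply_mem_idealSpan ?_ hx
    rintro _ ⟨r, hr, rfl⟩
    rw [NSOperad.freeIso_equiv_apply]
    exact span_le_idealSpan _ (h₁ r hr)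
  · intro y hy
    refine ⟨(NSOperad.freeIso k e).symm.equiv n y, ?_, LinearEquiv.apply_symm_apply _ _⟩
    refine (NSOperad.freeIso k e).symm.apply_mem_idealSpan ?_ hy
    rintro _ ⟨r, hr, rfl⟩
    rw [NSOperad.freeIso_symm_equiv_apply]
    exact span_le_idealSpan _ (h₂ r hr)

/-! ### Relations of the matching operads. -/

section Relations

variable {X : Type v} [Fintype X] {Ω : Type w}

theorem mixedRel_add (r s : PlanarTree X 3 →₀ k) (μ ν : Ω) :
    mixedRel (r + s) μ ν = mixedRel r μ ν + mixedRel s μ ν := by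
  simp only [mixedRel, Finsupp.add_apply, Finsupp.single_add, ← Finset.sum_add_distrib]
  refine Finset.sum_congr rfl fun i _ => Finset.sum_congr rfl fun j _ => ?_
  abel

theorem mixedRel_smul (c : k) (r : PlanarTree X 3 →₀ k) (μ ν : Ω) :
    mixedRel (c • r) μ ν = c • mixedRel r μ ν := by
  simp [mixedRel, Finset.smul_sum]

@[simp]
theorem mixedRel_zero (μ ν : Ω) : mixedRel (0 : PlanarTree X 3 →₀ k) μ ν = 0 := by
  simp [mixedRel]

/-- `mixedRel`, as a linear map. -/
noncomputable def mixedRelLinear (k : Type u) [Field k] (X : Type v) [Fintype X] (μ ν : Ω) :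
    (PlanarTree X 3 →₀ k) →ₗ[k] (PlanarTree (Ω × X) 3 →₀ k) where
  toFun r := mixedRel r μ ν
  map_add' r s := mixedRel_add r s μ ν
  map_smul' c r := mixedRel_smul c r μ ν

@[simp]
theorem mixedRelLinear_apply (r : PlanarTree X 3 →₀ k) (μ ν : Ω) :
    mixedRelLinear k X μ ν r = mixedRel r μ ν := rfl

theorem mixedRel_left (i j : X) (μ ν : Ω) :
    mixedRel (Finsupp.single (PlanarTree.left i j) (1 : k)) μ ν =
      Finsupp.single (PlanarTree.left (μ, i) (ν, j)) 1 := by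
  classical
  rw [mixedRel, Finset.sum_eq_single i, Finset.sum_eq_single j] <;>
    simp +contextual [Finsupp.single_apply, eq_comm]

theorem mixedRel_right (i j : X) (μ ν : Ω) :
    mixedRel (Finsupp.single (PlanarTree.right i j) (1 : k)) μ ν =
      Finsupp.single (PlanarTree.right (μ, i) (ν, j)) 1 := by
  classical
  rw [mixedRel, Finset.sum_eq_single i, Finset.sum_eq_single j] <;>
    simp +contextual [Finsupp.single_apply, eq_comm]

/-- Both sides are linear in `r` and agree on the trees of either shape. This removes the
distinction between diagonal and mixed relations. -/
theorem copyRel_eq_mixedRel (r : PlanarTree X 3 →₀ k) (ω : Ω) : copyRel r ω = mixedRel r ω ω := by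
  have : Finsupp.lmapDomain k k (PlanarTree.map (fun i : X => (ω, i))) =
      mixedRelLinear k X ω ω := by
    apply PlanarTree.linearMap_ext
    · intro i j
      simp [mixedRel_left]
    · intro i j
      simp [mixedRel_right]
  exact congrArg (fun f => f r) this

end Relations

theorem mem_matching_rel {P : BinaryQuadraticData.{u, v} k} {Ω : Type w} [Fintype Ω]
    {x : PlanarTree (Ω × P.Gen) 3 →₀ k} :
    x ∈ (P.matching Ω).Rel ↔ ∃ μ ν : Ω, ∃ r ∈ P.Rel, x = mixedRel r μ ν := by
  constructor
  · rintro (⟨ω, r, hr, rfl⟩ | ⟨μ, ν, -, r, hr, rfl⟩)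
    · exact ⟨ω, ω, r, hr, copyRel_eq_mixedRel r ω⟩
    · exact ⟨μ, ν, r, hr, rfl⟩
  · rintro ⟨μ, ν, r, hr, rfl⟩
    by_cases h : μ = ν
    · subst h
      exact Or.inl ⟨μ, r, hr, (copyRel_eq_mixedRel r μ).symm⟩
    · exact Or.inr ⟨μ, ν, h, r, hr, rfl⟩

/-- The relation `(x μ y) ν z - x μ (y ν z)` of the matching associative operad. -/
noncomputable def assocRel (k : Type u) [Field k] {Ω : Type w} (μ ν : Ω) :
    PlanarTree (Ω × Unit) 3 →₀ k :=
  Finsupp.single (PlanarTree.left (μ, ()) (ν, ())) 1 -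
    Finsupp.single (PlanarTree.right (μ, ()) (ν, ())) 1

theorem mem_matching_associative_rel {Ω : Type w} [Fintype Ω]
    {x : PlanarTree (Ω × Unit) 3 →₀ k} :
    x ∈ ((associative k).matching Ω).Rel ↔ ∃ μ ν : Ω, x = assocRel k μ ν := by
  refine mem_matching_rel.trans (exists_congr fun μ => exists_congr fun ν => ?_)
  have : mixedRel (Finsupp.single (PlanarTree.left () ()) (1 : k) -
      Finsupp.single (PlanarTree.right () ()) 1) μ ν = assocRel k μ ν := by
    rw [assocRel, ← mixedRel_left, ← mixedRel_right]
    exact (mixedRelLinear k Unit μ ν).map_sub _ _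
  constructor
  · rintro ⟨r, hr, rfl⟩
    obtain rfl := Set.mem_singleton_iff.1 hr
    exact this
  · rintro rfl
    exact ⟨_, Set.mem_singleton _, this.symm⟩

/-- The identification of the generators of `Mat(P)` with those of the products of `Mat(As)` and
`P`. -/
def matchingGenEquiv (Ω : Type w) (X : Type v) : Ω × X ≃ (Ω × Unit) × X :=
  (Equiv.prodPUnit Ω).symm.prodCongr (Equiv.refl X)

@[simp]
theorem matchingGenEquiv_apply (Ω : Type w) (X : Type v) (ω : Ω) (i : X) :
    matchingGenEquiv Ω X (ω, i) = ((ω, ()), i) := rfl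

@[simp]
theorem matchingGenEquiv_symm_apply (Ω : Type w) (X : Type v) (ω : Ω) (i : X) :
    (matchingGenEquiv Ω X).symm ((ω, ()), i) = (ω, i) := rfl

/-! ### Relations of the black and white products with the matching associative operad. -/

section Products

variable {X : Type v} {Ω : Type w}

/-- The coefficients of `assocRel k μ ν` vanish off the labels `μ, ν`, which leaves only the sum
over the labels in `X`. There the coefficient `-1` of the right tree meets the minus sign of the
black product. -/
theorem blackRel_assocRel [Fintype X] [Fintype Ω] (r : PlanarTree X 3 →₀ k) (μ ν : Ω) :
    blackRel (assocRel k μ ν) r =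
      Finsupp.mapDomain (PlanarTree.map (matchingGenEquiv Ω X)) (mixedRel r μ ν) := by
  classical
  rw [blackRel, Finset.sum_eq_single (μ, ()), Finset.sum_eq_single (ν, ())]
  · simp [assocRel, mixedRel, Finsupp.mapDomain_finsetSum, Finsupp.mapDomain_add]
  · rintro ⟨ν', ⟨⟩⟩ - h
    have h' : ν ≠ ν' := by rintro rfl; exact h rfl
    simp [assocRel, h']
  · simp
  · rintro ⟨μ', ⟨⟩⟩ - h
    have h' : μ ≠ μ' := by rintro rfl; exact h rfl
    simp [assocRel, h']
  · simp

open scoped TensorProduct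

/-- The linear form which adds the coefficients of `(x μ y) ν z` and of `x μ (y ν z)`. -/
noncomputable def assocCoeff (k : Type u) [Field k] {Ω : Type w} (μ ν : Ω) :
    (PlanarTree (Ω × Unit) 3 →₀ k) →ₗ[k] k :=
  Finsupp.lapply (PlanarTree.left (μ, ()) (ν, ())) +
    Finsupp.lapply (PlanarTree.right (μ, ()) (ν, ()))

/-- The coefficients `1` and `-1` are either both seen by the form, when the labels agree, or both
missed. -/
theorem assocCoeff_assocRel (μ ν μ' ν' : Ω) : assocCoeff k μ ν (assocRel k μ' ν') = 0 := by
  classical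
  simp [assocCoeff, assocRel, Finsupp.single_apply]

/-- The contraction of the first tensor factor with `assocCoeff`. -/
noncomputable def assocContract (k : Type u) [Field k] (X : Type v) {Ω : Type w} (μ ν : Ω) :
    (PlanarTree (Ω × Unit) 3 →₀ k) ⊗[k] (PlanarTree X 3 →₀ k) →ₗ[k] (PlanarTree X 3 →₀ k) :=
  (TensorProduct.lid k _).toLinearMap ∘ₗ LinearMap.rTensor _ (assocCoeff k μ ν)

@[simp]
theorem assocContract_tmul (μ ν : Ω) (a : PlanarTree (Ω × Unit) 3 →₀ k)
    (b : PlanarTree X 3 →₀ k) :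
    assocContract k X μ ν (a ⊗ₜ b) = assocCoeff k μ ν a • b := by
  simp [assocContract]

/-- The contraction kills `V ⊗ 𝒯(F)₃`, because the form vanishes on `V`, and it sends `a ⊗ b` with
`b ∈ U` to a multiple of `b`. -/
theorem assocContract_mem (μ ν : Ω) {V : Submodule k (PlanarTree (Ω × Unit) 3 →₀ k)}
    {U : Submodule k (PlanarTree X 3 →₀ k)} (hV : V ≤ LinearMap.ker (assocCoeff k μ ν))
    {t : (PlanarTree (Ω × Unit) 3 →₀ k) ⊗[k] (PlanarTree X 3 →₀ k)}
    (ht : t ∈ LinearMap.range (LinearMap.rTensor (PlanarTree X 3 →₀ k) V.subtype) ⊔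
      LinearMap.range (LinearMap.lTensor (PlanarTree (Ω × Unit) 3 →₀ k) U.subtype)) :
    assocContract k X μ ν t ∈ U := by
  refine (sup_le ?_ ?_ : _ ≤ U.comap (assocContract k X μ ν)) ht
  · rintro _ ⟨y, rfl⟩
    induction y with
    | zero => simp
    | add a b ha hb => rw [map_add]; exact add_mem ha hb
    | tmul a b =>
      have ha : assocCoeff k μ ν a.1 = 0 := hV a.2
      simp [ha]
  · rintro _ ⟨y, rfl⟩
    induction y with
    | zero => simp
    | add a b ha hb => rw [map_add]; exact add_mem ha hb
    | tmul a b => simpa using U.smul_mem _ b.2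

/-- On a tree, only the pair `(μ, ν)` of its own `Ω`-labels contributes: the contraction strips
these labels and `mixedRel` restores them. The form weights both shapes by `1`, so left and right
trees are recovered alike. -/
theorem sum_mixedRel_assocContract [Fintype X] [Fintype Ω] (x : PlanarTree ((Ω × Unit) × X) 3 →₀ k) :
    ∑ μ : Ω, ∑ ν : Ω,
        mixedRel (assocContract k X μ ν (splitDecorations k (Ω × Unit) X x)) μ ν =
      Finsupp.mapDomain (PlanarTree.map (matchingGenEquiv Ω X).symm) x := by
  classical
  have : ∑ μ : Ω, ∑ ν : Ω, mixedRelLinear k X μ ν ∘ₗ assocContract k X μ ν ∘ₗ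
        splitDecorations k (Ω × Unit) X =
      Finsupp.lmapDomain k k (PlanarTree.map (matchingGenEquiv Ω X).symm) := by
    apply PlanarTree.linearMap_ext
    · rintro ⟨⟨μ', ⟨⟩⟩, i⟩ ⟨⟨ν', ⟨⟩⟩, j⟩
      simp only [LinearMap.sum_apply, LinearMap.comp_apply]
      rw [Finset.sum_eq_single μ', Finset.sum_eq_single ν'] <;>
        simp +contextual [splitDecorations, assocCoeff, Finsupp.single_apply, mixedRel_left, eq_comm]
    · rintro ⟨⟨μ', ⟨⟩⟩, i⟩ ⟨⟨ν', ⟨⟩⟩, j⟩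
      simp only [LinearMap.sum_apply, LinearMap.comp_apply]
      rw [Finset.sum_eq_single μ', Finset.sum_eq_single ν'] <;>
        simp +contextual [splitDecorations, assocCoeff, Finsupp.single_apply, mixedRel_right, eq_comm]
  simpa using congrArg (fun f => f x) this

/-- The projection onto the span of the trees `right i j`, along the span of the trees
`left i j`. -/
noncomputable def rightPart (k : Type u) [Field k] (X : Type v) :
    (PlanarTree X 3 →₀ k) →ₗ[k] (PlanarTree X 3 →₀ k) :=
  open Classical in
  Finsupp.linearCombination k
    (fun t => if ∃ i j, t = PlanarTree.right i j then Finsupp.single t 1 else 0)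

/-- In the first factor, the right tree labelled `μ, ν` is the left one minus `assocRel k μ ν`. The
correction is therefore needed only on the right trees of `r`. -/
theorem splitDecorations_mixedRel [Fintype X] (r : PlanarTree X 3 →₀ k) (μ ν : Ω) :
    splitDecorations k (Ω × Unit) X
        (Finsupp.mapDomain (PlanarTree.map (matchingGenEquiv Ω X)) (mixedRel r μ ν)) =
      (-assocRel k μ ν) ⊗ₜ[k] rightPart k X r +
        Finsupp.single (PlanarTree.left (μ, ()) (ν, ())) (1 : k) ⊗ₜ[k] r := by
  have h : splitDecorations k (Ω × Unit) X ∘ₗ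
        Finsupp.lmapDomain k k (PlanarTree.map (matchingGenEquiv Ω X)) ∘ₗ mixedRelLinear k X μ ν =
      TensorProduct.mk k (PlanarTree (Ω × Unit) 3 →₀ k) (PlanarTree X 3 →₀ k)
          (-assocRel k μ ν) ∘ₗ rightPart k X +
        TensorProduct.mk k (PlanarTree (Ω × Unit) 3 →₀ k) (PlanarTree X 3 →₀ k)
          (Finsupp.single (PlanarTree.left (μ, ()) (ν, ())) (1 : k)) := by
    apply PlanarTree.linearMap_ext
    · intro i j
      simp [mixedRel_left, splitDecorations, rightPart]
    · intro i j
      simp [mixedRel_right, splitDecorations, rightPart, assocRel, ← TensorProduct.add_tmul]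
  exact congrArg (fun f => f r) h

theorem splitDecorations_mixedRel_mem [Fintype X] {r : PlanarTree X 3 →₀ k} (μ ν : Ω)
    {V : Submodule k (PlanarTree (Ω × Unit) 3 →₀ k)} {U : Submodule k (PlanarTree X 3 →₀ k)}
    (hV : assocRel k μ ν ∈ V) (hU : r ∈ U) :
    splitDecorations k (Ω × Unit) X
        (Finsupp.mapDomain (PlanarTree.map (matchingGenEquiv Ω X)) (mixedRel r μ ν)) ∈
      LinearMap.range (LinearMap.rTensor (PlanarTree X 3 →₀ k) V.subtype) ⊔
        LinearMap.range (LinearMap.lTensor (PlanarTree (Ω × Unit) 3 →₀ k) U.subtype) := by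
  rw [splitDecorations_mixedRel]
  refine Submodule.add_mem_sup ?_ ?_
  · exact ⟨(⟨_, neg_mem hV⟩ : V) ⊗ₜ[k] rightPart k X r, rfl⟩
  · exact ⟨TensorProduct.mk k (PlanarTree (Ω × Unit) 3 →₀ k) U
      (Finsupp.single (PlanarTree.left (μ, ()) (ν, ())) 1) ⟨r, hU⟩, rfl⟩

end Products

/-! ### The two isomorphisms. -/

theorem nonempty_iso_black (P : BinaryQuadraticData.{u, w} k) (Ω : Type v) [Fintype Ω] :
    Nonempty (NSOperad.Iso (P.matching Ω).operad
      (((associative k).matching Ω).black P).operad) := by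
  refine nonempty_iso_of_equiv _ _ (matchingGenEquiv Ω P.Gen) ?_ ?_
  · intro x hx
    obtain ⟨μ, ν, r, hr, rfl⟩ := mem_matching_rel.1 hx
    exact Submodule.subset_span ⟨_, mem_matching_associative_rel.2 ⟨μ, ν, rfl⟩, r, hr,
      (blackRel_assocRel r μ ν).symm⟩
  · rintro _ ⟨s, hs, r, hr, rfl⟩
    obtain ⟨μ, ν, rfl⟩ := mem_matching_associative_rel.1 hs
    refine Submodule.subset_span (mem_matching_rel.2 ⟨μ, ν, r, hr, ?_⟩)
    refine (congrArg _ (blackRel_assocRel r μ ν)).trans ?_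
    -- What remains is that relabelling forth and back is the identity, read off from the
    -- isomorphism of free operads.
    have h := LinearEquiv.symm_apply_apply
      ((NSOperad.freeIso k (matchingGenEquiv Ω P.Gen)).equiv 3) (mixedRel r μ ν)
    rw [NSOperad.freeIso_equiv_apply] at h
    exact (NSOperad.freeIso_symm_equiv_apply _ _).symm.trans h

theorem nonempty_iso_white (P : BinaryQuadraticData.{u, w} k) (Ω : Type v) [Fintype Ω] :
    Nonempty (NSOperad.Iso (P.matching Ω).operad
      (((associative k).matching Ω).white P).operad) := by
  refine nonempty_iso_of_equiv _ _ (matchingGenEquiv Ω P.Gen) ?_ ?_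
  · intro x hx
    obtain ⟨μ, ν, r, hr, rfl⟩ := mem_matching_rel.1 hx
    have hV : assocRel k μ ν ∈ Submodule.span k ((associative k).matching Ω).Rel :=
      Submodule.subset_span (mem_matching_associative_rel.2 ⟨μ, ν, rfl⟩)
    exact Submodule.subset_span
      (splitDecorations_mixedRel_mem μ ν hV (Submodule.subset_span hr))
  · intro x hx
    -- The relabelled `x` is replaced by its expansion into mixed relations, so each summand can be
    -- treated separately.
    refine (sum_mixedRel_assocContract (k := k) (X := P.Gen) (Ω := Ω) x).symm ▸ ?_
    refine Submodule.sum_mem _ fun μ _ => Submodule.sum_mem _ fun ν _ => ?_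
    have h₁ : assocContract k P.Gen μ ν (splitDecorations k (Ω × Unit) P.Gen x) ∈
        Submodule.span k P.Rel := by
      refine assocContract_mem μ ν (Submodule.span_le.2 fun s hs => ?_) hx
      obtain ⟨μ', ν', rfl⟩ := mem_matching_associative_rel.1 hs
      exact assocCoeff_assocRel μ ν μ' ν'
    -- The contraction lies only in the span of the relations of `P`, so linearity of `mixedRel` in
    -- `r` is needed to land in the span of the matching relations.
    have h₂ : Submodule.span k P.Rel ≤
        (Submodule.span k (P.matching Ω).Rel).comap (mixedRelLinear k P.Gen μ ν) :=
      Submodule.span_le.2 fun r hr => Submodule.subset_span (mem_matching_rel.2 ⟨μ, ν, r, hr, rfl⟩)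
    exact h₂ h₁

end BinaryQuadraticData

theorem mainTheorem6 {k : Type u} [Field k] [CharZero k] {Ω : Type v} [Fintype Ω] [Nonempty Ω]
    (P : BinaryQuadraticData.{u, w} k) :
    Nonempty (NSOperad.Iso (P.matching Ω).operad
      (((BinaryQuadraticData.associative k).matching Ω).black P).operad) ∧
    Nonempty (NSOperad.Iso (P.matching Ω).operad
      (((BinaryQuadraticData.associative k).matching Ω).white P).operad) := by
  exact ⟨P.nonempty_iso_black Ω, P.nonempty_iso_white Ω⟩
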